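/- Let $q$ be a prime power, let $d$ be a positive integer with $d\mid q-1$, and set $m:=\frac{q-1}{d}$. Fix a primitive root $\omega$ of $\mathbb{F}_q$, let $C$ be the index $d$ subgroup of $\mathbb{F}_q^{\ast}$, and set $C_i:=\omega^iC$ for $i=0,1,\ldots,d-1$. A generalized cyclotomic mapping of $\mathbb{F}_q$ of index $d$ is a function $f:\mathbb{F}_q\rightarrow\mathbb{F}_q$ such that $f(0)=0$ and, for suitable $a_0,\ldots,a_{d-1}\in\mathbb{F}_q$ and $r_0,\ldots,r_{d-1}\in\{1,\ldots,m\}$, $f(x)=a_ix^{r_i}$ for all $x\in C_i$ and all $i\in\{0,\ldots,d-1\}$ (this notion does not depend on the choice of $\omega$). Let $\operatorname{GCP}(d,q)$ be the group of all permutations of $\mathbb{F}_q^{\ast}$ that are restrictions of bijective generalized cyclotomic mappings of $\mathbb{F}_q$ of index $d$. A long-cycle element of $\operatorname{GCP}(d,q)$ is an element that is a $(q-1)$-cycle on $\mathbb{F}_q^{\ast}$. An involution in a group $G$ is an element $g\in G$ with $g^2=1_G$ (so $1_G$ is an involution). A complete system of representatives of the conjugacy classes of long-cycle elements (respectively, of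 involutions) in a group $G$ is a family of such elements in which each conjugacy class of such elements of $G$ is represented by exactly one member of the family. Let $\operatorname{rad}'(m)$ be the product of the distinct primes dividing $m$ if $4\nmid m$, and twice that product if $4\mid m$. Let $\operatorname{Hol}(\mathbb{Z}/m\mathbb{Z})$ be the group of all permutations $\lambda(a,b):x\mapsto ax+b$ of $\mathbb{Z}/m\mathbb{Z}$ with $\gcd(a,m)=1$. Each of its elements is written uniquely as $\lambda(a,b)$ with $a,b\in\{0,1,\ldots,m-1\}$ and $\gcd(a,m)=1$, and a tuple of elements is called lexicographically ordered if the associated pairs $(a,b)$ are weakly increasing in the lexicographical order. 1. The following is a complete system of representatives of the conjugacy classes of long-cycle elements in $\operatorname{GCP}(d,q)$: for each $a\in\{1+k\operatorname{rad}'(m): k=0,1,\ldots,\frac{m}{\operatorname{rad}'(m)}-1\}$, the permutation $L_a:\mathbb{F}_q^{\ast}\rightarrow\mathbb{F}_q^{\ast}$ with $$L_a(x)=\begin{cases}\omega x, & \text{if }x\notin C_{d-1}, \\ \omega^{d-(d-1)a}x^a, & \text{if }x\in C_{d-1}.\end{cases}$$ 2. Let $R$ be any complete system of representatives of the conjugacy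 classes of involutions in $\operatorname{Hol}(\mathbb{Z}/m\mathbb{Z})$. The following is a complete system of representatives of the conjugacy classes of involutions in $\operatorname{GCP}(d,q)$: for each $k=0,1,\ldots,\lfloor\frac{d}{2}\rfloor$ and each lexicographically ordered $(d-2k)$-tuple $\vec{\iota}=(\lambda(a_j,b_j))_{j=2k,2k+1,\ldots,d-1}$ of elements of $R$ (with $a_j,b_j\in\{0,1,\ldots,m-1\}$), the permutation $I_{k,\vec{\iota}}:\mathbb{F}_q^{\ast}\rightarrow\mathbb{F}_q^{\ast}$ with $$I_{k,\vec{\iota}}(x)=\begin{cases}\omega x, & \text{if }x\in\bigcup_{i=0}^{k-1}{C_{2i}}, \\ \omega^{-1}x, & \text{if }x\in\bigcup_{i=0}^{k-1}{C_{2i+1}}, \\ \omega^{db_j+(1-a_j)j}x^{a_j}, & \text{if }x\in C_j\text{ for some }j=2k,2k+1,\ldots,d-1.\end{cases}$$ -/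

import Mathlib

namespace GenCyc

/-- `rep` is a complete system of representatives of the conjugacy classes of `G` whose elements
satisfy `P`: every `rep i` satisfies `P`, and every `g` satisfying `P` is conjugate in `G` to
`rep i` for exactly one index `i`. -/
def IsCompleteSystem {G : Type*} [Group G] (P : G → Prop) {ι : Type*} (rep : ι → G) : Prop :=
  (∀ i, P (rep i)) ∧ ∀ g, P g → ∃! i, IsConj (rep i) g

/-- The squarefree radical of `m` if `4 ∤ m`, and twice this radical if `4 ∣ m`. -/
def rad' (m : ℕ) : ℕ :=
  if 4 ∣ m then 2 * ∏ p ∈ m.primeFactors, p else ∏ p ∈ m.primeFactors, p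

/-! ### Affine permutations of `ℤ/mℤ` -/

/-- The affine permutation `x ↦ a x + b` of `ℤ/mℤ`. -/
def lam {m : ℕ} (a : (ZMod m)ˣ) (b : ZMod m) : Equiv.Perm (ZMod m) where
  toFun x := a * x + b
  invFun y := (a⁻¹ : (ZMod m)ˣ) * (y - b)
  left_inv x := by simp
  right_inv y := by simp

theorem lam_apply {m : ℕ} (a : (ZMod m)ˣ) (b x : ZMod m) : lam a b x = a * x + b := rfl

/-- The holomorph of `ℤ/mℤ`: the group of all its affine permutations. -/
def Hol (m : ℕ) : Subgroup (Equiv.Perm (ZMod m)) where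
  carrier := {g | ∃ (a : (ZMod m)ˣ) (b : ZMod m), g = lam a b}
  one_mem' := ⟨1, 0, by ext x; simp [lam_apply]⟩
  mul_mem' := by
    rintro _ _ ⟨a, b, rfl⟩ ⟨a', b', rfl⟩
    refine ⟨a * a', a * b' + b, Equiv.ext fun x => ?_⟩
    simp only [Equiv.Perm.mul_apply, lam_apply, Units.val_mul]
    ring
  inv_mem' := by
    rintro _ ⟨a, b, rfl⟩
    refine ⟨a⁻¹, -((a⁻¹ : (ZMod m)ˣ) * b), inv_eq_of_mul_eq_one_right (Equiv.ext fun x => ?_)⟩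
    simp [lam_apply, mul_add]

/-- The pair `(a, b)` of natural numbers `< m` for which `g` is the map `x ↦ a x + b`
(see `coeffs_spec`). -/
def coeffs {m : ℕ} (g : Hol m) : ℕ × ℕ :=
  ((g.1 1 - g.1 0).val, (g.1 0).val)

theorem coeffs_spec {m : ℕ} (hm : 0 < m) (g : Hol m) :
    (coeffs g).1 < m ∧ (coeffs g).2 < m ∧ (coeffs g).1.Coprime m ∧
      ∀ x : ZMod m, g.1 x = ((coeffs g).1 : ZMod m) * x + ((coeffs g).2 : ZMod m) := by
  have : NeZero m := ⟨hm.ne'⟩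
  obtain ⟨g, a, b, rfl⟩ := g
  have h1 : coeffs (⟨lam a b, a, b, rfl⟩ : Hol m) = ((a : ZMod m).val, b.val) := by
    simp [coeffs, lam_apply]
  rw [h1]
  exact ⟨ZMod.val_lt _, ZMod.val_lt _, ZMod.val_coe_unit_coprime a, fun x => by simp [lam_apply]⟩

/-- The lexicographical ordering of tuples of affine permutations, with respect to the standard
coefficients `(a, b)`. -/
def LexOrdered {m n : ℕ} (t : Fin n → Hol m) : Prop :=
  ∀ i j : Fin n, i ≤ j → toLex (coeffs (t i)) ≤ toLex (coeffs (t j))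

/-! ### Generalized cyclotomic permutations -/

section

variable (F : Type*) [Field F]

/-- The index `d` subgroup `C` of the multiplicative group (for `d ∣ |F| - 1`), as the group of
all `d`-th powers. -/
def indexSubgroup (d : ℕ) : Subgroup Fˣ :=
  (powMonoidHom d : Fˣ →* Fˣ).range

theorem index_indexSubgroup [Finite F] (d : ℕ) (hd : d ∣ Nat.card F - 1) :
    (indexSubgroup F d).index = d := by
  rw [indexSubgroup, IsCyclic.index_powMonoidHom_range, Nat.card_units]
  exact Nat.gcd_eq_right hd

variable {F}

/-- `ω` is a primitive root of `F`. -/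
def IsPrimitiveElt (ω : Fˣ) : Prop := ∀ x : Fˣ, x ∈ Subgroup.zpowers ω

/-- The coset `C_i = ω^i C`. -/
def coset (ω : Fˣ) (d i : ℕ) : Set Fˣ :=
  {x | ∃ c ∈ indexSubgroup F d, x = ω ^ i * c}

/-- `f = f_ω(a, r)`, that is, `f 0 = 0` and `f x = a_i x ^ r_i` for `x ∈ C_i`. -/
def IsCyclotomicForm (ω : Fˣ) (d : ℕ) (a : Fin d → F) (r : Fin d → ℕ) (f : F → F) : Prop :=
  f 0 = 0 ∧ ∀ i : Fin d, ∀ x ∈ coset ω d i, f x = a i * (x : F) ^ r i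

/-- `f` is a generalized cyclotomic mapping of index `d`. By `isGenCyclotomicMapping_iff_of_primitive`
this does not depend on the choice of the primitive root. -/
def IsGenCyclotomicMapping (d : ℕ) (f : F → F) : Prop :=
  ∃ ω : Fˣ, IsPrimitiveElt ω ∧ ∃ (a : Fin d → F) (r : Fin d → ℕ),
    (∀ i, 1 ≤ r i ∧ r i ≤ (Nat.card F - 1) / d) ∧ IsCyclotomicForm ω d a r f

theorem coset_eq_coset [Finite F] {d : ℕ} (hd : d ∣ Nat.card F - 1) {ω : Fˣ}
    (hω : IsPrimitiveElt ω) (y : Fˣ) : ∃ i : Fin d, y ∈ coset ω d i := by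
  have hd0 : 0 < d := Nat.pos_of_dvd_of_pos hd (by have := Finite.one_lt_card (α := F); omega)
  have hz : (d : ℤ) ≠ 0 := by exact_mod_cast hd0.ne'
  obtain ⟨n, rfl⟩ := hω y
  have h0 := Int.emod_nonneg n hz
  have h1 := Int.emod_lt_of_pos n (Int.natCast_pos.2 hd0)
  refine ⟨⟨(n % d).toNat, by omega⟩, ω ^ (d * (n / d)), ⟨ω ^ (n / d), ?_⟩, ?_⟩
  · simp [mul_comm (d : ℤ), zpow_mul]
  · have : (ω ^ (n % d).toNat : Fˣ) = ω ^ (n % d) := by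
      rw [← zpow_natCast, Int.toNat_of_nonneg h0]
    simp only [this, ← zpow_add, Int.emod_add_mul_ediv]

theorem isGenCyclotomicMapping_of_coset [Finite F] {d : ℕ} (hd : d ∣ Nat.card F - 1) {ω : Fˣ}
    {f : F → F}
    (h : f 0 = 0 ∧ ∀ y : Fˣ, ∃ (a : F) (r : ℕ), 1 ≤ r ∧
      ∀ c ∈ indexSubgroup F d, f (y * c) = a * (y * c : F) ^ r) :
    ∃ (a : Fin d → F) (r : Fin d → ℕ),
      (∀ i, 1 ≤ r i ∧ r i ≤ (Nat.card F - 1) / d) ∧ IsCyclotomicForm ω d a r f := by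
  have hq : 0 < Nat.card F - 1 := by have := Finite.one_lt_card (α := F); omega
  have hd0 : 0 < d := Nat.pos_of_dvd_of_pos hd hq
  set m := (Nat.card F - 1) / d with hm
  have hdm : d * m = Nat.card F - 1 := Nat.mul_div_cancel' hd
  have hm0 : 0 < m := Nat.div_pos (Nat.le_of_dvd hq hd) hd0
  obtain ⟨h0, h⟩ := h
  choose a r hr hf using h
  refine ⟨fun i => a (ω ^ (i : ℕ)) * (ω ^ (i : ℕ) : F) ^ (m * ((r (ω ^ (i : ℕ)) - 1) / m)),
    fun i => (r (ω ^ (i : ℕ)) - 1) % m + 1, fun i => ⟨Nat.le_add_left _ _, Nat.mod_lt _ hm0⟩, h0, ?_⟩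
  · rintro i _ ⟨c, hc, rfl⟩
    have h1 := hf (ω ^ (i : ℕ)) c hc
    have h2 := hr (ω ^ (i : ℕ))
    set s := r (ω ^ (i : ℕ))
    have hcm : c ^ m = 1 := by
      obtain ⟨z, rfl⟩ := hc
      simp only [powMonoidHom_apply]
      rw [← pow_mul, hdm, ← Nat.card_units, pow_card_eq_one']
    have hcm' : (c : F) ^ m = 1 := by
      rw [← Units.val_pow_eq_pow_val, hcm, Units.val_one]
    have h3 : s = m * ((s - 1) / m) + ((s - 1) % m + 1) := by
      have := Nat.div_add_mod (s - 1) m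
      omega
    push_cast at h1 ⊢
    rw [h1]
    conv_lhs => rw [h3, pow_add]
    rw [mul_pow _ _ (m * _), pow_mul (c : F), hcm', one_pow, mul_one, ← mul_assoc]

theorem isGenCyclotomicMapping_iff_coset [Finite F] {d : ℕ} (hd : d ∣ Nat.card F - 1)
    {f : F → F} :
    IsGenCyclotomicMapping d f ↔ f 0 = 0 ∧ ∀ y : Fˣ, ∃ (a : F) (r : ℕ), 1 ≤ r ∧
      ∀ c ∈ indexSubgroup F d, f (y * c) = a * (y * c : F) ^ r := by
  constructor
  · rintro ⟨ω, hω, a, r, hr, h0, h⟩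
    refine ⟨h0, fun y => ?_⟩
    obtain ⟨i, c, hc, rfl⟩ := coset_eq_coset hd hω y
    refine ⟨a i, r i, (hr i).1, fun c' hc' => ?_⟩
    simpa [mul_assoc] using h i (ω ^ (i : ℕ) * c * c') ⟨c * c', mul_mem hc hc', mul_assoc _ _ _⟩
  · intro h
    obtain ⟨ω, hω⟩ := IsCyclic.exists_generator (α := Fˣ)
    exact ⟨ω, hω, isGenCyclotomicMapping_of_coset hd h⟩

theorem isGenCyclotomicMapping_iff_of_primitive [Finite F] {d : ℕ} (hd : d ∣ Nat.card F - 1)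
    {ω : Fˣ} (hω : IsPrimitiveElt ω) {f : F → F} :
    IsGenCyclotomicMapping d f ↔ ∃ (a : Fin d → F) (r : Fin d → ℕ),
      (∀ i, 1 ≤ r i ∧ r i ≤ (Nat.card F - 1) / d) ∧ IsCyclotomicForm ω d a r f :=
  ⟨fun h => isGenCyclotomicMapping_of_coset hd ((isGenCyclotomicMapping_iff_coset hd).1 h),
    fun h => ⟨ω, hω, h⟩⟩

/-- `g` is the restriction to the multiplicative group of a generalized cyclotomic permutation of
index `d`. -/
def IsGCP (d : ℕ) (g : Equiv.Perm Fˣ) : Prop :=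
  ∃ f : F → F, IsGenCyclotomicMapping d f ∧ Function.Bijective f ∧ ∀ x : Fˣ, f x = g x

theorem IsGCP.one [Finite F] {d : ℕ} (hd : d ∣ Nat.card F - 1) :
    IsGCP d (1 : Equiv.Perm Fˣ) :=
  ⟨id, (isGenCyclotomicMapping_iff_coset hd).2
    ⟨rfl, fun y => ⟨1, 1, le_rfl, fun c _ => by simp⟩⟩, Function.bijective_id, fun x => rfl⟩

theorem IsGCP.mul [Finite F] {d : ℕ} (hd : d ∣ Nat.card F - 1) {g g' : Equiv.Perm Fˣ}
    (hg : IsGCP d g) (hg' : IsGCP d g') : IsGCP d (g * g') := by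
  obtain ⟨f, hf, hb, hfg⟩ := hg
  obtain ⟨f', hf', hb', hfg'⟩ := hg'
  refine ⟨f ∘ f', (isGenCyclotomicMapping_iff_coset hd).2 ?_, hb.comp hb',
    fun x => by simp [hfg, hfg']⟩
  obtain ⟨h0, h⟩ := (isGenCyclotomicMapping_iff_coset hd).1 hf
  obtain ⟨h0', h'⟩ := (isGenCyclotomicMapping_iff_coset hd).1 hf'
  refine ⟨by simp [h0, h0'], fun y => ?_⟩
  obtain ⟨a, r, hr, hy⟩ := h' y
  obtain ⟨b, s, hs, hz⟩ := h (g' y)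
  refine ⟨b * a ^ s, r * s, Nat.mul_pos hr hs, fun c hc => ?_⟩
  have h1 : ((g' y : Fˣ) : F) = a * (y : F) ^ r := by
    rw [← hfg']
    simpa using hy 1 (one_mem _)
  have h2 : f' (y * c) = (g' y : Fˣ) * ((c ^ r : Fˣ) : F) := by
    rw [hy c hc, h1]
    push_cast
    ring
  rw [Function.comp_apply, h2, hz (c ^ r) (pow_mem hc r), h1]
  push_cast
  ring

/-- The permutation group `GCP(d, q)` on the multiplicative group of `F`. -/
def GCP (F : Type*) [Field F] [Finite F] (d : ℕ) (hd : d ∣ Nat.card F - 1) :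
    Subgroup (Equiv.Perm Fˣ) where
  carrier := {g | IsGCP d g}
  one_mem' := IsGCP.one hd
  mul_mem' := IsGCP.mul hd
  inv_mem' := by
    intro g hg
    have hpow : ∀ n : ℕ, IsGCP d (g ^ n) := fun n => by
      induction n with
      | zero => simpa using IsGCP.one hd
      | succ n ih => simpa [pow_succ] using ih.mul hd hg
    have h : g⁻¹ = g ^ (orderOf g - 1) := by
      refine inv_eq_of_mul_eq_one_right ?_
      rw [← pow_succ', Nat.sub_add_cancel (orderOf_pos g), pow_orderOf_eq_one]
    change IsGCP d g⁻¹
    rw [h]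
    exact hpow _

/-- `g` is a long cycle: a cycle of length `|F| - 1`, running through all of `Fˣ`
(for `|F| = 2` this is the identity of a one-point set). -/
def IsLongCycle [Finite F] {d : ℕ} {hd : d ∣ Nat.card F - 1} (g : GCP F d hd) : Prop :=
  g.1.IsCycleOn Set.univ

/-- `g` is an involution, where the identity counts as an involution. -/
def IsInvolution {G : Type*} [Group G] (g : G) : Prop := g ^ 2 = 1

/-- `f` is the map `L_a`. -/
def IsL (ω : Fˣ) (d a : ℕ) (f : Fˣ → Fˣ) : Prop :=
  (∀ x ∉ coset ω d (d - 1), f x = ω * x) ∧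
  ∀ x ∈ coset ω d (d - 1), f x = ω ^ ((d : ℤ) - ((d : ℤ) - 1) * (a : ℤ)) * x ^ a

/-- `f` is the map `I_{k,t}`. The entry of the tuple `t` at position `j = 0, …, d - 2k - 1` belongs
to the coset with index `2k + j`. -/
def IsI (ω : Fˣ) (d k : ℕ) {m : ℕ} (t : Fin (d - 2 * k) → Hol m) (f : Fˣ → Fˣ) : Prop :=
  (∀ i < k, ∀ x ∈ coset ω d (2 * i), f x = ω * x) ∧
  (∀ i < k, ∀ x ∈ coset ω d (2 * i + 1), f x = ω⁻¹ * x) ∧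
  ∀ j : Fin (d - 2 * k), ∀ x ∈ coset ω d (2 * k + j),
    f x = ω ^ ((d : ℤ) * ((coeffs (t j)).2 : ℤ) +
      (1 - ((coeffs (t j)).1 : ℤ)) * ((2 * k + j : ℕ) : ℤ)) * x ^ (coeffs (t j)).1

end

/-- The parameters `a = 1 + k rad'(m)`, `k = 0, …, m / rad'(m) - 1`. -/
def LIndex (m : ℕ) : Set ℕ := {a | ∃ k < m / rad' m, a = 1 + k * rad' m}

/-- The parameters `(k, t)`, where `0 ≤ k ≤ d / 2` and `t` is a lexicographically ordered
`(d - 2k)`-tuple with entries in `R`. -/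
structure IIndex (d m : ℕ) (R : Set (Hol m)) where
  k : ℕ
  hk : k ≤ d / 2
  t : Fin (d - 2 * k) → Hol m
  mem : ∀ j, t j ∈ R
  ordered : LexOrdered t

end GenCyc

/-! Writing a nonzero element as `ω ^ (i + d z)` with `i < d` and `z` modulo `m = (q - 1) / d` turns
the cosets into blocks `{i} × ℤ/mℤ`. In these coordinates `GCP` is the imprimitive wreath product of
`Hol m` with the symmetric group on the blocks (`isGCP_iff`), so both statements are conjugacy
problems in a wreath product.

Long cycles: the blocks are permuted in one `d`-cycle, and following an orbit straightens every step
except the return to the first block, which carries some `c` in `Hol m` (`exists_conj_blockCycle`).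
The class of `c` is an invariant (`exists_conj_of_blockCycle_conj`), and the map is a long cycle
exactly when `c` is one on `ℤ/mℤ`. By the Hull–Dobell criterion this means that `c` is `x ↦ u x + b`
with `b` a unit and `u ≡ 1` modulo `rad' m`. Scaling makes `b = 1` (`exists_conj_hol_one`), and `u`
is an invariant because linear parts commute (`eq_of_conj_hol_one`).

Involutions: a pair of interchanged blocks can be straightened to a pure swap, and each fixed block
carries an involution of `Hol m`, which can be moved into `R` (`exists_conj_blockInv`). The multiset
of these representatives is a complete invariant; sorting makes it a tuple (`eq_of_blockInv_conj`).
-/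

namespace GenCyc

/-! ### Block maps -/

section BlockMap

open Equiv

variable {I J K T : Type*} {H : Subgroup (Perm T)}

/-- `w` permutes the blocks `{i} × T`, and acts on each of them by an element of `H`. -/
def IsBlockMap (H : Subgroup (Perm T)) (w : I × T ≃ J × T) : Prop :=
  ∃ (σ : I ≃ J) (h : I → H), ∀ i t, w (i, t) = (σ i, (h i).1 t)

theorem isBlockMap_prodShear (σ : I ≃ J) (h : I → H) :
    IsBlockMap H (σ.prodShear fun i => (h i).1) := ⟨σ, h, fun _ _ => rfl⟩

theorem IsBlockMap.trans {w : I × T ≃ J × T} {w' : J × T ≃ K × T} (hw : IsBlockMap H w)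
    (hw' : IsBlockMap H w') : IsBlockMap H (w.trans w') := by
  obtain ⟨σ, h, hw⟩ := hw
  obtain ⟨σ', h', hw'⟩ := hw'
  exact ⟨σ.trans σ', fun i => h' (σ i) * h i, fun i t => by simp [hw, hw']⟩

theorem IsBlockMap.symm {w : I × T ≃ J × T} (hw : IsBlockMap H w) : IsBlockMap H w.symm := by
  obtain ⟨σ, h, hw⟩ := hw
  exact ⟨σ.symm, fun j => (h (σ.symm j))⁻¹, fun j t => by simp [Equiv.symm_apply_eq, hw]⟩

theorem blockMap_pow_apply {g : Perm (I × T)} {σ : Perm I} {h : I → H}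
    (hg : ∀ i t, g (i, t) = (σ i, (h i).1 t)) (k : ℕ) :
    ∃ u : I → H, ∀ i t, (g ^ k) (i, t) = ((σ ^ k) i, (u i).1 t) := by
  induction k with
  | zero => exact ⟨1, fun i t => by simp⟩
  | succ k ih =>
    obtain ⟨u, hu⟩ := ih
    exact ⟨fun i => h ((σ ^ k) i) * u i, fun i t => by simp [pow_succ', hu, hg]⟩

/-! ### Permutations that rotate the blocks. -/

/-- The permutation that moves each block to the next one, and applies `c` when it returns from
the last block to the first. -/
def blockCycle (n : ℕ) (c : H) : Perm (Fin (n + 1) × T) :=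
  (finRotate (n + 1)).prodShear fun i => if i = Fin.last n then c.1 else 1

theorem isBlockMap_blockCycle (n : ℕ) (c : H) : IsBlockMap H (blockCycle n c) :=
  ⟨finRotate (n + 1), fun i => if i = Fin.last n then c else 1, fun i t => by
    by_cases hi : i = Fin.last n <;> simp [blockCycle, hi]⟩

theorem blockCycle_last (n : ℕ) (c : H) (t : T) :
    blockCycle n c (Fin.last n, t) = (0, c.1 t) := by
  simp [blockCycle]

theorem blockCycle_of_lt (n : ℕ) (c : H) {i : ℕ} (hi : i < n) (t : T) :
    blockCycle n c (⟨i, by omega⟩, t) = (⟨i + 1, by omega⟩, t) := by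
  have : (⟨i, by omega⟩ : Fin (n + 1)) ≠ Fin.last n := by simp [Fin.ext_iff, hi.ne]
  simp [blockCycle, this, finRotate_of_lt hi]

theorem blockCycle_pow_apply_zero (n : ℕ) (c : H) {i : ℕ} (hi : i < n + 1) (t : T) :
    (blockCycle n c ^ i) (0, t) = (⟨i, hi⟩, t) := by
  induction i with
  | zero => rfl
  | succ i ih =>
    rw [pow_succ', Perm.mul_apply, ih (by omega), blockCycle_of_lt n c (by omega)]

theorem blockCycle_pow_succ_apply (n : ℕ) (c : H) (x : Fin (n + 1) × T) :
    (blockCycle n c ^ (n + 1)) x = (x.1, c.1 x.2) := by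
  obtain ⟨⟨i, hi⟩, t⟩ := x
  have h0 : ∀ t, (blockCycle n c ^ (n + 1)) (0, t) = (0, c.1 t) := fun t => by
    rw [pow_succ', Perm.mul_apply, blockCycle_pow_apply_zero n c (Nat.lt_succ_self n)]
    exact blockCycle_last n c t
  have hi0 := blockCycle_pow_apply_zero n c hi
  rw [← hi0, ← Perm.mul_apply, (Commute.refl _).pow_pow _ _, Perm.mul_apply, h0, hi0, hi0]

theorem blockCycle_pow_mul_apply (n : ℕ) (c : H) (k : ℕ) (x : Fin (n + 1) × T) :
    (blockCycle n c ^ ((n + 1) * k)) x = (x.1, (c.1 ^ k) x.2) := by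
  rw [pow_mul]
  induction k generalizing x with
  | zero => simp
  | succ k ih => rw [pow_succ, Perm.mul_apply, blockCycle_pow_succ_apply, ih, pow_succ,
      Perm.mul_apply]

theorem isCycleOn_univ_iff {X : Type*} {g : Perm X} :
    g.IsCycleOn Set.univ ↔ ∀ x y, g.SameCycle x y :=
  ⟨fun h x y => h.2 (Set.mem_univ x) (Set.mem_univ y),
    fun h => ⟨Set.bijOn_univ.2 g.bijective, fun x _ y _ => h x y⟩⟩

theorem isCycleOn_blockCycle [Finite T] {n : ℕ} {c : H} (hc : c.1.IsCycleOn Set.univ) :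
    (blockCycle n c).IsCycleOn Set.univ := by
  rw [isCycleOn_univ_iff] at hc ⊢
  have h0 : ∀ x, (blockCycle n c).SameCycle (0, x.2) x := fun ⟨⟨i, hi⟩, t⟩ =>
    ⟨i, by rw [zpow_natCast, blockCycle_pow_apply_zero n c hi]⟩
  have h1 : ∀ s t, (blockCycle n c).SameCycle (0, s) (0, t) := fun s t => by
    obtain ⟨k, hk⟩ := (hc s t).exists_nat_pow_eq
    exact ⟨((n + 1) * k : ℕ), by rw [zpow_natCast, blockCycle_pow_mul_apply, hk]⟩
  exact fun x y => ((h0 x).symm.trans (h1 _ _)).trans (h0 y)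

/-- Full turns act on block `0` by powers of `c`; the remaining steps of an incomplete turn only
change the block index. -/
theorem isCycleOn_of_isCycleOn_blockCycle [Finite T] {n : ℕ} {c : H}
    (hc : (blockCycle n c).IsCycleOn Set.univ) : c.1.IsCycleOn Set.univ := by
  rw [isCycleOn_univ_iff] at hc ⊢
  intro s t
  obtain ⟨N, hN⟩ := (hc (0, s) (0, t)).exists_nat_pow_eq
  refine ⟨(N / (n + 1) : ℕ), ?_⟩
  rw [← Nat.mod_add_div N (n + 1), pow_add, Perm.mul_apply, blockCycle_pow_mul_apply,
    blockCycle_pow_apply_zero n c (Nat.mod_lt _ n.succ_pos)] at hN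
  rw [zpow_natCast]
  exact congrArg Prod.snd hN

/-- The conjugator sends `(i, t)` to `g ^ i (0, t)`. It intertwines trivially before the last block.
There, `g ^ (n + 1)` has come back to block `0`, and its action on that block is taken as `c`. -/
theorem exists_conj_blockCycle [Finite T] [Nonempty T] {n : ℕ} {g : Perm (Fin (n + 1) × T)}
    (hg : IsBlockMap H g) (hc : g.IsCycleOn Set.univ) :
    ∃ (c : H) (w : Perm (Fin (n + 1) × T)), IsBlockMap H w ∧
      ∀ x, w (blockCycle n c x) = g (w x) := by
  obtain ⟨σ, h, hg⟩ := hg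
  choose u hu using fun k => blockMap_pow_apply hg k
  rw [isCycleOn_univ_iff] at hc
  have hσ : Perm.IsCycleOn σ ((Finset.univ : Finset (Fin (n + 1))) : Set (Fin (n + 1))) := by
    rw [Finset.coe_univ, isCycleOn_univ_iff]
    intro i j
    obtain ⟨t⟩ := ‹Nonempty T›
    obtain ⟨N, hN⟩ := (hc (i, t) (j, t)).exists_nat_pow_eq
    exact ⟨N, by simpa using congrArg Prod.fst ((hu N i t).symm.trans hN)⟩
  have h0 : (σ ^ (n + 1)) 0 = 0 := by simpa using hσ.pow_card_apply (Finset.mem_univ 0)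
  have hρ : Function.Surjective fun i : Fin (n + 1) => (σ ^ (i : ℕ)) 0 := fun j => by
    obtain ⟨k, hk, hj⟩ := hσ.exists_pow_eq (Finset.mem_univ 0) (Finset.mem_univ j)
    exact ⟨⟨k, by simpa using hk⟩, hj⟩
  refine ⟨u (n + 1) 0, _, isBlockMap_prodShear
    (Equiv.ofBijective _ (Finite.surjective_iff_bijective.1 hρ)) fun i => u i 0, ?_⟩
  have hw : ∀ (i : ℕ) t, ((σ ^ i) 0, (u i 0).1 t) = (g ^ i) (0, t) :=
    fun i t => (hu i 0 t).symm
  rintro ⟨⟨i, hi⟩, t⟩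
  rcases (Nat.lt_succ_iff.1 hi).lt_or_eq with hin | rfl
  · rw [blockCycle_of_lt n _ hin]
    simp only [Equiv.prodShear_apply, Equiv.ofBijective_apply]
    rw [hw, hw, pow_succ', Perm.mul_apply]
  · have : (⟨i, hi⟩ : Fin (i + 1)) = Fin.last i := rfl
    rw [this, blockCycle_last]
    simp only [Equiv.prodShear_apply, Equiv.ofBijective_apply]
    rw [hw, hw, ← Perm.mul_apply, Fin.val_last, ← pow_succ', hu (i + 1), h0]
    rfl

theorem blockCycle_conj {n : ℕ} {c c' u : H} (h : u * c = c' * u) :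
    ∃ w : Perm (Fin (n + 1) × T), IsBlockMap H w ∧
      ∀ x, w (blockCycle n c x) = blockCycle n c' (w x) := by
  refine ⟨_, isBlockMap_prodShear (Equiv.refl _) fun _ => u, ?_⟩
  have h' : ∀ t, u.1 (c.1 t) = c'.1 (u.1 t) := fun t =>
    Equiv.congr_fun (congrArg Subtype.val h) t
  rintro ⟨i, t⟩
  by_cases hi : i = Fin.last n <;> simp [blockCycle, hi, h']

/-- The `(n + 1)`-th powers act by `c`, respectively `c'`, on every block, so the component of `w`
on block `0` intertwines them, whichever block it lands in. -/
theorem exists_conj_of_blockCycle_conj {n : ℕ} {c c' : H} {w : Perm (Fin (n + 1) × T)}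
    (hw : IsBlockMap H w) (h : ∀ x, w (blockCycle n c x) = blockCycle n c' (w x)) :
    ∃ u : H, ∀ t, u.1 (c.1 t) = c'.1 (u.1 t) := by
  obtain ⟨σ, u, hu⟩ := hw
  have hp : ∀ (k : ℕ) x, w ((blockCycle n c ^ k) x) = (blockCycle n c' ^ k) (w x) := by
    intro k
    induction k with
    | zero => simp
    | succ k ih => intro x; simp only [pow_succ', Perm.mul_apply, h, ih]
  refine ⟨u 0, fun t => ?_⟩
  have := hp (n + 1) (0, t)
  rw [blockCycle_pow_succ_apply, blockCycle_pow_succ_apply, hu, hu] at this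
  exact congrArg Prod.snd this

/-! ### Block maps that are involutions. -/

/-- The permutation that interchanges the blocks `(i, 0)` and `(i, 1)`, and applies `t j` on the
block `j`. -/
def blockInv (k : ℕ) {n : ℕ} (t : Fin n → H) : Perm (((Fin k × Fin 2) ⊕ Fin n) × T) :=
  (Equiv.sumCongr (Equiv.prodCongr (Equiv.refl (Fin k)) Fin.revPerm) (Equiv.refl (Fin n))).prodShear
    (Sum.elim 1 fun j => (t j).1)

@[simp] theorem blockInv_inl {k n : ℕ} (t : Fin n → H) (i : Fin k) (b : Fin 2) (s : T) :
    blockInv k t (Sum.inl (i, b), s) = (Sum.inl (i, b.rev), s) := rfl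

@[simp] theorem blockInv_inr {k n : ℕ} (t : Fin n → H) (j : Fin n) (s : T) :
    blockInv k t (Sum.inr j, s) = (Sum.inr j, (t j).1 s) := rfl

theorem isBlockMap_blockInv (k : ℕ) {n : ℕ} (t : Fin n → H) : IsBlockMap H (blockInv k t) :=
  ⟨Equiv.sumCongr (Equiv.prodCongr (Equiv.refl (Fin k)) Fin.revPerm) (Equiv.refl (Fin n)),
    Sum.elim 1 t, by rintro (i | i) s <;> simp [blockInv]⟩

theorem blockInv_blockInv {k n : ℕ} {t : Fin n → H} (ht : ∀ j, IsInvolution (t j)) (x) :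
    blockInv k t (blockInv k t x) = x := by
  obtain ⟨⟨i, b⟩ | j, s⟩ := x
  · simp
  · have := Equiv.congr_fun (congrArg Subtype.val (ht j)) s
    simpa [pow_two] using this

theorem exists_conj_blockInv [Fintype I] [LinearOrder I] {A : Type*} [LinearOrder A]
    (key : H → A) {R : Set H} (hR : ∀ g : H, IsInvolution g → ∃ r ∈ R, IsConj r g)
    {g : Perm (I × T)} (hg : IsBlockMap H g) (hgg : ∀ x, g (g x) = x) (hT : Nonempty T) :
    ∃ (k n : ℕ) (t : Fin n → H), (∀ j, t j ∈ R) ∧ Monotone (key ∘ t) ∧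
      ∃ w : ((Fin k × Fin 2) ⊕ Fin n) × T ≃ I × T, IsBlockMap H w ∧
        ∀ x, w (blockInv k t x) = g (w x) := by
  obtain ⟨σ, h, hg⟩ := hg
  have hgg' : ∀ i s, σ (σ i) = i ∧ (h (σ i)).1 ((h i).1 s) = s := fun i s => by
    have := hgg (i, s)
    rw [hg, hg] at this
    exact ⟨congrArg Prod.fst this, congrArg Prod.snd this⟩
  have hσ : ∀ i, σ (σ i) = i := fun i => (hgg' i hT.some).1
  have hfix : ∀ i : {i // σ i = i}, ∃ r : H, r ∈ R ∧ ∃ u : H, u * r = h i * u := fun i => by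
    obtain ⟨r, hr, hc⟩ := hR (h i) (Subtype.ext (Equiv.ext fun s => by
      simpa [pow_two, i.2] using (hgg' i s).2))
    obtain ⟨u, hu⟩ := isConj_iff.1 hc
    exact ⟨r, hr, u, by rw [← hu]; group⟩
  choose r hrR u hu using hfix
  -- The order on `I` selects the smaller block of each interchanged pair.
  let a := (Fintype.equivFin {i // i < σ i}).symm
  let b₀ := (Fintype.equivFin {i // σ i = i}).symm
  let b := (Tuple.sort (key ∘ r ∘ b₀)).trans b₀
  let π : (Fin _ × Fin 2) ⊕ Fin _ → I :=
    Sum.elim (fun x => if x.2 = 0 then (a x.1).1 else σ (a x.1)) fun j => (b j).1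
  have hπ : Function.Bijective π := by
    constructor
    · have key1 : ∀ i j, (a i).1 ≠ σ (a j) := fun i j hij => by
        have h1 := (a i).2
        have h2 := (a j).2
        rw [hij, hσ] at h1
        exact lt_asymm h1 h2
      have key2 : ∀ i j, (a i).1 ≠ (b j).1 := fun i j hij => by
        have h1 := (a i).2
        rw [hij, (b j).2] at h1
        exact lt_irrefl _ h1
      have key3 : ∀ i j, σ (a i) ≠ (b j).1 := fun i j hij => by
        refine key2 i j ?_
        rw [← hσ (a i), hij, (b j).2]
      rintro (⟨i, x⟩ | i) (⟨j, y⟩ | j) hij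
      · fin_cases x <;> fin_cases y <;> simp [π] at hij
        · simpa using a.injective (Subtype.ext hij)
        · exact (key1 _ _ hij).elim
        · exact (key1 _ _ hij.symm).elim
        · simpa using a.injective (Subtype.ext hij)
      · fin_cases x <;> simp [π] at hij
        · exact (key2 _ _ hij).elim
        · exact (key3 _ _ hij).elim
      · fin_cases y <;> simp [π] at hij
        · exact (key2 _ _ hij.symm).elim
        · exact (key3 _ _ hij.symm).elim
      · have : b i = b j := Subtype.ext hij
        rw [b.injective this]
    · intro i
      rcases lt_trichotomy i (σ i) with hi | hi | hi
      · exact ⟨Sum.inl (a.symm ⟨i, hi⟩, 0), by simp [π]⟩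
      · exact ⟨Sum.inr (b.symm ⟨i, hi.symm⟩), by simp [π]⟩
      · exact ⟨Sum.inl (a.symm ⟨σ i, by rwa [hσ]⟩, 1), by simp [π, hσ]⟩
  -- On a pair, the identity on the smaller block and `h` on its partner absorb the twist, since `h
  -- (σ i)` inverts `h i`.
  refine ⟨_, _, r ∘ b, fun j => hrR _, Tuple.monotone_sort (key ∘ r ∘ b₀), _,
    isBlockMap_prodShear (Equiv.ofBijective π hπ)
      (Sum.elim (fun x => if x.2 = 0 then 1 else h (a x.1)) fun j => u (b j)), ?_⟩
  rintro ⟨⟨i, x⟩ | j, s⟩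
  · fin_cases x
    · simp [π, hg]
    · simp [π, hg, hσ, (hgg' _ _).2]
  · have := Equiv.congr_fun (congrArg Subtype.val (hu (b j))) s
    simp only [Subgroup.coe_mul, Perm.mul_apply] at this
    simp [π, hg, this, (b j).2]

theorem exists_injective_of_blockInv_conj {R : Set H}
    (hR : ∀ r ∈ R, ∀ r' ∈ R, IsConj r r' → r = r') {k k' n n' : ℕ} {t : Fin n → H}
    {t' : Fin n' → H} (ht : ∀ j, t j ∈ R) (ht' : ∀ j, t' j ∈ R)
    {w : ((Fin k × Fin 2) ⊕ Fin n) × T ≃ ((Fin k' × Fin 2) ⊕ Fin n') × T}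
    (hw : IsBlockMap H w) (h : ∀ x, w (blockInv k t x) = blockInv k' t' (w x)) (hT : Nonempty T) :
    ∃ τ : Fin n → Fin n', Function.Injective τ ∧ t' ∘ τ = t := by
  obtain ⟨σ, u, hu⟩ := hw
  have key : ∀ j, ∃ j', σ (Sum.inr j) = Sum.inr j' ∧ t' j' = t j := fun j => by
    have hj := fun s => h (Sum.inr j, s)
    simp only [blockInv_inr, hu] at hj
    rcases hσ : σ (Sum.inr j) with ⟨i, b⟩ | j'
    -- A fixed block cannot go to a swapped one, because `Fin.rev` has no fixed point on `Fin 2`.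
    · have := congrArg Prod.fst (hj hT.some)
      simp only [hσ, blockInv_inl] at this
      revert this
      fin_cases b <;> simp
    · refine ⟨j', rfl, (hR _ (ht j) _ (ht' j') (isConj_iff.2 ⟨u (Sum.inr j), ?_⟩)).symm⟩
      rw [mul_inv_eq_iff_eq_mul]
      refine Subtype.ext (Equiv.ext fun s => ?_)
      simpa [hσ] using hj s
  choose τ hτ hτt using key
  refine ⟨τ, fun i j hij => ?_, funext hτt⟩
  have : σ (Sum.inr i) = σ (Sum.inr j) := by rw [hτ, hτ, hij]
  simpa using this

theorem eq_of_blockInv_conj {A : Type*} [LinearOrder A] {key : H → A}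
    (hkey : Function.Injective key) {R : Set H}
    (hR : ∀ r ∈ R, ∀ r' ∈ R, IsConj r r' → r = r') {k k' n n' : ℕ} {t : Fin n → H}
    {t' : Fin n' → H} (ht : ∀ j, t j ∈ R) (ht' : ∀ j, t' j ∈ R) (hm : Monotone (key ∘ t))
    (hm' : Monotone (key ∘ t'))
    {w : ((Fin k × Fin 2) ⊕ Fin n) × T ≃ ((Fin k' × Fin 2) ⊕ Fin n') × T}
    (hw : IsBlockMap H w) (h : ∀ x, w (blockInv k t x) = blockInv k' t' (w x)) (hT : Nonempty T) :
    n = n' ∧ HEq t t' := by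
  obtain ⟨τ, hτ, htτ⟩ := exists_injective_of_blockInv_conj hR ht ht' hw h hT
  obtain ⟨τ', hτ', -⟩ := exists_injective_of_blockInv_conj hR ht' ht hw.symm
    (fun x => by simp [Equiv.symm_apply_eq, h]) hT
  obtain rfl : n = n' := le_antisymm (by simpa using Fintype.card_le_of_injective τ hτ)
    (by simpa using Fintype.card_le_of_injective τ' hτ')
  refine ⟨rfl, heq_of_eq ?_⟩
  -- Both `key ∘ t' ∘ τ` and `key ∘ t'` are sorted rearrangements of the same tuple, hence equal.
  have := Tuple.unique_monotone (f := key ∘ t')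
    (σ := Equiv.ofBijective τ (Finite.injective_iff_bijective.1 hτ)) (τ := 1)
    (by rw [← htτ] at hm; exact hm) hm'
  rw [← htτ]
  exact funext fun j => hkey (congrFun this j)

end BlockMap

/-! ### Long cycles in the holomorph -/

section Holomorph

open Equiv

/-- This unpacks `rad'` into the local conditions of the Hull–Dobell criterion, which are also what
lifting the exponent requires. -/
theorem rad'_dvd_iff {m : ℕ} (hm : m ≠ 0) (x : ℤ) :
    (rad' m : ℤ) ∣ x ↔ (∀ p : ℕ, p.Prime → p ∣ m → (p : ℤ) ∣ x) ∧ (4 ∣ m → 4 ∣ x) := by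
  have h4 : (4 : ℤ) ∣ x ↔ 4 ∣ x.natAbs := Int.natCast_dvd (m := 4)
  simp only [Int.natCast_dvd, h4]
  generalize x.natAbs = y
  have hprod : ∏ p ∈ m.primeFactors, p ∣ y ↔ ∀ p : ℕ, p.Prime → p ∣ m → p ∣ y :=
    ⟨fun h p hp hpm =>
      (Finset.dvd_prod_of_mem _ (Nat.mem_primeFactors.2 ⟨hp, hpm, hm⟩)).trans h,
    fun h => Finset.prod_primes_dvd y (fun p hp => (Nat.prime_of_mem_primeFactors hp).prime)
      fun p hp => h p (Nat.prime_of_mem_primeFactors hp) (Nat.dvd_of_mem_primeFactors hp)⟩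
  unfold rad'
  split_ifs with h
  · have h2 : 2 ∈ m.primeFactors :=
      Nat.mem_primeFactors.2 ⟨Nat.prime_two, (by norm_num : 2 ∣ 4).trans h, hm⟩
    rw [← hprod, ← Finset.mul_prod_erase _ _ h2, ← mul_assoc]
    refine ⟨fun hy => ⟨(mul_dvd_mul_right (by norm_num) _).trans hy,
      fun _ => (Dvd.intro _ rfl).trans hy⟩, fun hy => ?_⟩
    refine Nat.Coprime.mul_dvd_of_dvd_of_dvd ?_ (hy.2 h) ((Dvd.intro_left _ rfl).trans hy.1)
    refine Nat.Coprime.prod_right fun p hp => ?_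
    have hp' := Finset.mem_erase.1 hp
    exact ((Nat.coprime_primes Nat.prime_two (Nat.prime_of_mem_primeFactors hp'.2)).2
      hp'.1.symm).pow_left 2
  · simp [hprod, h]

theorem rad'_dvd {m : ℕ} (hm : m ≠ 0) : rad' m ∣ m := by
  rw [← Int.natCast_dvd_natCast, rad'_dvd_iff hm]
  exact ⟨fun p _ h => Int.natCast_dvd_natCast.2 h, fun h => Int.natCast_dvd_natCast.2 h⟩

/-- The multiplicity of `p` in `1 + a + ⋯ + a ^ (n - 1)`. -/
theorem emultiplicity_geom_sum {p : ℕ} (hp : p.Prime) {a : ℤ} (ha : a ≠ 1) (hpa : (p : ℤ) ∣ a - 1)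
    (h2 : p = 2 → 4 ∣ a - 1) (n : ℕ) :
    emultiplicity (p : ℤ) (∑ i ∈ Finset.range n, a ^ i) = emultiplicity p n := by
  have hpZ : Prime (p : ℤ) := Nat.prime_iff_prime_int.1 hp
  have hpa' : ¬ (p : ℤ) ∣ a := fun h => hpZ.not_dvd_one (by simpa using dvd_sub h hpa)
  have hfin : emultiplicity (p : ℤ) (a - 1) ≠ ⊤ := by
    rw [← finiteMultiplicity_iff_emultiplicity_ne_top]
    exact Int.finiteMultiplicity_iff.2 ⟨by simpa using hp.one_lt.ne', sub_ne_zero.2 ha⟩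
  -- The multiplicity of `a - 1` is added to both sides: the sum becomes `a ^ n - 1`, to which
  -- lifting the exponent applies.
  refine ENat.add_right_injective_of_ne_top hfin ?_
  beta_reduce
  rw [add_comm, ← emultiplicity_mul hpZ, geom_sum_mul]
  rcases hp.eq_two_or_odd' with rfl | hodd
  · have := Int.two_pow_sub_pow' (x := a) (y := 1) n (h2 rfl) (by simpa using hpa')
    rw [one_pow] at this
    rw [← Int.natCast_emultiplicity]
    exact this
  · simpa using Int.emultiplicity_pow_sub_pow hp hodd (y := 1) hpa hpa' n

/-- Each prime power dividing `m` is handled by `emultiplicity_geom_sum`. The exception is `p = 2`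
with `a ≢ 1` modulo `4`: then `4 ∤ m`, and only parity matters, where a sum of `n` odd terms is
congruent to `n`. -/
theorem dvd_of_dvd_geom_sum {m : ℕ} (hm : m ≠ 0) {a : ℤ} (ha1 : a ≠ 1) (ha : (rad' m : ℤ) ∣ a - 1)
    {n : ℕ} (h : (m : ℤ) ∣ ∑ i ∈ Finset.range n, a ^ i) : m ∣ n := by
  obtain ⟨hap, ha4⟩ := (rad'_dvd_iff hm _).1 ha
  rw [Nat.dvd_iff_prime_pow_dvd_dvd]
  intro p k hp hk
  rcases Nat.eq_zero_or_pos k with rfl | hk0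
  · simp
  have hpm : p ∣ m := (dvd_pow_self p hk0.ne').trans hk
  have hS : (p : ℤ) ^ k ∣ ∑ i ∈ Finset.range n, a ^ i :=
    dvd_trans (by exact_mod_cast hk) h
  by_cases h2 : p = 2 → 4 ∣ a - 1
  · rwa [pow_dvd_iff_le_emultiplicity, emultiplicity_geom_sum hp ha1 (hap p hp hpm) h2,
      ← pow_dvd_iff_le_emultiplicity] at hS
  · push Not at h2
    obtain ⟨rfl, h4⟩ := h2
    have hk1 : k = 1 := by
      by_contra hk1
      exact h4 (ha4 ((pow_dvd_pow 2 (by omega : 2 ≤ k)).trans hk))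
    subst hk1
    have h1 : ((a : ℤ) : ZMod 2) = 1 := by
      have := (ZMod.intCast_zmod_eq_zero_iff_dvd (a - 1) 2).2 (hap 2 hp hpm)
      push_cast at this
      exact sub_eq_zero.1 this
    rw [pow_one] at hS ⊢
    have := (ZMod.intCast_zmod_eq_zero_iff_dvd _ 2).2 hS
    push_cast at this
    rw [h1] at this
    simpa [ZMod.natCast_eq_zero_iff] using this

variable {m : ℕ}

theorem lam_one_pow_apply_zero (u : (ZMod m)ˣ) (n : ℕ) :
    (lam u 1 ^ n) 0 = ∑ i ∈ Finset.range n, (u : ZMod m) ^ i := by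
  induction n with
  | zero => simp
  | succ n ih =>
    rw [pow_succ', Perm.mul_apply, ih, lam_apply, geom_sum_succ]

theorem isCycleOn_lam_one (hm : m ≠ 0) {u : (ZMod m)ˣ} {a : ℤ} (hu : (u : ZMod m) = a)
    (ha : (rad' m : ℤ) ∣ a - 1) : (lam u 1).IsCycleOn Set.univ := by
  have : NeZero m := ⟨hm⟩
  -- The representative `a = 1` is replaced by `1 + m`, so that `a - 1` has finite multiplicities.
  wlog ha1 : a ≠ 1 generalizing a
  · refine this (a := a + m) (by simp [hu]) ?_ (by push Not at ha1; simp [ha1, hm])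
    rw [add_sub_right_comm]
    exact dvd_add ha (Int.natCast_dvd_natCast.2 (rad'_dvd hm))
  have hdvd : ∀ n : ℕ, (lam u 1 ^ n) 0 = 0 → m ∣ n := fun n hn => by
    rw [lam_one_pow_apply_zero, hu] at hn
    refine dvd_of_dvd_geom_sum hm ha1 ha ?_
    rw [← ZMod.intCast_zmod_eq_zero_iff_dvd]
    exact_mod_cast hn
  have hle : ∀ i j : ℕ, j < m → i ≤ j → (lam u 1 ^ i) 0 = (lam u 1 ^ j) 0 → i = j := by
    intro i j hj hij h
    obtain ⟨k, rfl⟩ := Nat.exists_eq_add_of_le hij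
    rw [pow_add, Perm.mul_apply] at h
    have := Nat.eq_zero_of_dvd_of_lt (hdvd k ((lam u 1 ^ i).injective h).symm) (by omega)
    omega
  have hinj : Function.Injective fun i : Fin m => (lam u 1 ^ (i : ℕ)) 0 := fun i j hij => by
    rcases le_total (i : ℕ) j with h | h
    · exact Fin.ext (hle _ _ j.2 h hij)
    · exact (Fin.ext (hle _ _ i.2 h hij.symm)).symm
  have hsurj := ((Fintype.bijective_iff_injective_and_card _).2 ⟨hinj, by simp⟩).2
  have h0 : ∀ x, (lam u 1).SameCycle 0 x := fun x => by
    obtain ⟨i, hi⟩ := hsurj x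
    exact ⟨(i : ℕ), by rw [zpow_natCast]; exact hi⟩
  exact ⟨Set.bijOn_univ.2 (lam u 1).bijective, fun x _ y _ => (h0 x).symm.trans (h0 y)⟩

/-! ### Necessary conditions for an affine map to be a full cycle. -/

theorem mem_of_isCycleOn_univ {X : Type*} [Finite X] {f : Perm X} (hf : f.IsCycleOn Set.univ)
    {S : Set X} (hS : ∀ x ∈ S, f x ∈ S) {x : X} (hx : x ∈ S) (y : X) : y ∈ S := by
  obtain ⟨n, rfl⟩ := (hf.2 (Set.mem_univ x) (Set.mem_univ y)).exists_nat_pow_eq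
  induction n with
  | zero => simpa
  | succ n ih => rw [pow_succ', Perm.mul_apply]; exact hS _ ih

/-- The fibre over a fixed residue would be invariant, hence everything, yet `0` and `1` have
distinct residues. -/
theorem lam_castHom_no_fixed [NeZero m] {u : (ZMod m)ˣ} {b : ZMod m}
    (h : (lam u b).IsCycleOn Set.univ) {p : ℕ} (hp : 1 < p) (hpm : p ∣ m) (y : ZMod p) :
    ZMod.castHom hpm (ZMod p) u * y + ZMod.castHom hpm (ZMod p) b ≠ y := by
  intro hy
  have : Fact (1 < p) := ⟨hp⟩
  obtain ⟨x, hx⟩ := ZMod.castHom_surjective hpm y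
  have key := mem_of_isCycleOn_univ h (S := {x | ZMod.castHom hpm (ZMod p) x = y})
    (fun x hx => by
      rw [Set.mem_ofPred_eq] at hx ⊢
      rw [lam_apply, map_add, map_mul, hx, hy]) hx
  have h0 : ZMod.castHom hpm (ZMod p) 0 = y := key 0
  have h1 : ZMod.castHom hpm (ZMod p) 1 = y := key 1
  rw [map_zero] at h0
  rw [map_one, ← h0] at h1
  exact one_ne_zero h1

theorem castHom_eq_one_of_isCycleOn_lam [NeZero m] {u : (ZMod m)ˣ} {b : ZMod m}
    (h : (lam u b).IsCycleOn Set.univ) {p : ℕ} (hp : p.Prime) (hpm : p ∣ m) :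
    ZMod.castHom hpm (ZMod p) u = 1 ∧ ZMod.castHom hpm (ZMod p) b ≠ 0 := by
  have : Fact p.Prime := ⟨hp⟩
  have h1 : ZMod.castHom hpm (ZMod p) u = 1 := by
    by_contra hu
    have hu' := sub_ne_zero.2 hu
    -- If `u ≢ 1`, the affine map modulo `p` has the fixed point `-b / (u - 1)`.
    refine lam_castHom_no_fixed h hp.one_lt hpm
      (-ZMod.castHom hpm (ZMod p) b / (ZMod.castHom hpm (ZMod p) u - 1)) ?_
    field_simp
    ring
  exact ⟨h1, fun hb => lam_castHom_no_fixed h hp.one_lt hpm 0 (by rw [hb]; simp)⟩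

/-- Otherwise `u ≡ 3` modulo `4`, and `x ↦ 3 x + c` interchanges `0` and `c` because `4 c = 0`. The
residues `{0, c}` would then be all of `ℤ/4ℤ`. -/
theorem castHom_four_eq_one_of_isCycleOn_lam [NeZero m] {u : (ZMod m)ˣ} {b : ZMod m}
    (h : (lam u b).IsCycleOn Set.univ) (hm : 4 ∣ m) : ZMod.castHom hm (ZMod 4) u = 1 := by
  have key := mem_of_isCycleOn_univ h (x := 0)
    (S := {x | ZMod.castHom hm (ZMod 4) x = 0 ∨ ZMod.castHom hm (ZMod 4) x =
      ZMod.castHom hm (ZMod 4) b})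
  simp only [Set.mem_ofPred_eq, lam_apply, map_add, map_mul, map_zero, true_or, true_imp_iff] at key
  have hu : IsUnit (ZMod.castHom hm (ZMod 4) (u : ZMod m)) := u.isUnit.map _
  generalize ZMod.castHom hm (ZMod 4) (u : ZMod m) = a at key hu ⊢
  generalize ZMod.castHom hm (ZMod 4) b = c at key
  have ha : ∀ a : ZMod 4, IsUnit a → a = 1 ∨ a = 3 := by decide
  rcases ha a hu with rfl | rfl
  · rfl
  · have h4 : (4 : ZMod 4) = 0 := rfl
    have key' := key (fun x hx => by
      rcases hx with hx | hx
      · exact Or.inr (by simp [hx])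
      · exact Or.inl (by rw [hx]; linear_combination c * h4))
    have h1 := key' 1
    have h2 := key' 2
    have h3 := key' 3
    rw [map_one] at h1
    rw [map_ofNat] at h2 h3
    clear key key'
    revert c
    decide

/-- The affine permutation `x ↦ u x + b`, as an element of the holomorph. -/
def hol (u : (ZMod m)ˣ) (b : ZMod m) : Hol m := ⟨lam u b, u, b, rfl⟩

theorem hol_apply (u : (ZMod m)ˣ) (b x : ZMod m) : (hol u b).1 x = u * x + b := rfl

theorem exists_hol_eq (g : Hol m) : ∃ u b, g = hol u b := by
  obtain ⟨g, u, b, rfl⟩ := g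
  exact ⟨u, b, rfl⟩

/-- The translation part is nonzero modulo every prime dividing `m`, hence a unit, and
multiplication by it is the conjugator. The index `k` is the quotient of the residue of `u - 1` by
`rad' m`. -/
theorem exists_conj_hol_one (hm : m ≠ 0) {c : Hol m} (hc : c.1.IsCycleOn Set.univ) :
    ∃ a ∈ LIndex m, ∃ u : (ZMod m)ˣ, (u : ZMod m) = (a : ℕ) ∧ ∃ v : Hol m, v * hol u 1 = c * v := by
  have : NeZero m := ⟨hm⟩
  obtain ⟨u, b, rfl⟩ := exists_hol_eq c
  have hb : IsUnit b := by
    rw [← ZMod.natCast_zmod_val b, ZMod.isUnit_iff_coprime]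
    refine Nat.Coprime.symm (Nat.coprime_of_dvd fun p hp hpm hpb => ?_)
    refine (castHom_eq_one_of_isCycleOn_lam hc hp hpm).2 ?_
    rw [← ZMod.natCast_zmod_val b, map_natCast, ZMod.natCast_eq_zero_iff]
    exact hpb
  obtain ⟨v, rfl⟩ := hb
  have hval : ∀ {p : ℕ} (hpm : p ∣ m), ZMod.castHom hpm (ZMod p) u = 1 →
      p ∣ ((u : ZMod m) - 1).val := fun {p} hpm h1 => by
    rw [← ZMod.natCast_eq_zero_iff, ← map_natCast (ZMod.castHom hpm (ZMod p)),
      ZMod.natCast_zmod_val, map_sub, h1, map_one, sub_self]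
  have hr : rad' m ∣ ((u : ZMod m) - 1).val := by
    rw [← Int.natCast_dvd_natCast, rad'_dvd_iff hm]
    exact ⟨fun p hp hpm => Int.natCast_dvd_natCast.2
        (hval hpm (castHom_eq_one_of_isCycleOn_lam hc hp hpm).1),
      fun h4 => Int.natCast_dvd_natCast.2 (hval h4 (castHom_four_eq_one_of_isCycleOn_lam hc h4))⟩
  obtain ⟨k, hk⟩ := hr
  refine ⟨1 + k * rad' m, ⟨k, ?_, rfl⟩, u, ?_, hol v 0, ?_⟩
  · obtain ⟨l, hl⟩ := rad'_dvd hm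
    have hlt := ZMod.val_lt ((u : ZMod m) - 1)
    have h0 : 0 < rad' m := Nat.pos_of_dvd_of_pos (rad'_dvd hm) (Nat.pos_of_ne_zero hm)
    rw [Nat.lt_div_iff_mul_lt' (rad'_dvd hm), ← hk]
    exact hlt
  · rw [mul_comm k, ← hk]
    simp
  · refine Subtype.ext (Equiv.ext fun x => ?_)
    simp only [Subgroup.coe_mul, Perm.mul_apply, hol_apply]
    ring

theorem eq_of_conj_hol_one {u u' : (ZMod m)ˣ} {v : Hol m}
    (h : ∀ x, v.1 ((hol u 1).1 x) = (hol u' 1).1 (v.1 x)) : u = u' := by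
  obtain ⟨w, b, rfl⟩ := exists_hol_eq v
  have h0 := h 0
  have h1 := h 1
  simp only [hol_apply] at h0 h1
  refine Units.ext ((Units.mul_right_inj w).1 ?_)
  linear_combination h1 - h0

theorem rad'_dvd_sub_one_of_mem_LIndex {a : ℕ} (ha : a ∈ LIndex m) :
    (rad' m : ℤ) ∣ (a : ℤ) - 1 := by
  obtain ⟨k, -, rfl⟩ := ha
  push_cast
  simp

theorem coprime_of_mem_LIndex (hm : m ≠ 0) {a : ℕ} (ha : a ∈ LIndex m) : a.Coprime m := by
  refine Nat.coprime_of_dvd fun p hp hpa hpm => ?_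
  have h1 := ((rad'_dvd_iff hm _).1 (rad'_dvd_sub_one_of_mem_LIndex ha)).1 p hp hpm
  have h2 := dvd_sub (Int.natCast_dvd_natCast.2 hpa) h1
  exact (Nat.prime_iff_prime_int.1 hp).not_dvd_one (by simpa using h2)

theorem eq_of_mem_LIndex (hm : m ≠ 0) {a a' : ℕ} (ha : a ∈ LIndex m) (ha' : a' ∈ LIndex m)
    (h : (a : ZMod m) = a') : a = a' := by
  have key : ∀ k, k < m / rad' m → k * rad' m < m := fun k hk =>
    (Nat.lt_div_iff_mul_lt' (rad'_dvd hm) k).1 hk |>.trans_eq' (mul_comm _ _)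
  obtain ⟨k, hk, rfl⟩ := ha
  obtain ⟨k', hk', rfl⟩ := ha'
  rw [Nat.cast_add, Nat.cast_add, add_right_inj, ZMod.natCast_eq_natCast_iff] at h
  rw [Nat.ModEq.eq_of_lt_of_lt h (key k hk) (key k' hk')]

end Holomorph

/-! ### Generalized cyclotomic permutations as block maps -/

section BlockEquiv

open Equiv

theorem zpow_add_mul_congr {F : Type*} [Field F] {d : ℕ} (hd : d ∣ Nat.card F - 1) (ω : Fˣ) (i : ℤ) {z z' : ℤ}
    (h : (z : ZMod ((Nat.card F - 1) / d)) = z') : ω ^ (i + d * z) = ω ^ (i + d * z') := by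
  obtain ⟨k, hk⟩ := (ZMod.intCast_eq_intCast_iff_dvd_sub _ _ _).1 h
  have h1 : (i + d * z' : ℤ) = i + d * z + (Nat.card Fˣ : ℕ) * k := by
    rw [Nat.card_units, ← Nat.mul_div_cancel' hd, Nat.cast_mul]
    linear_combination (d : ℤ) * hk
  rw [h1, zpow_add _ (i + d * z), zpow_mul _ ((Nat.card Fˣ : ℕ) : ℤ), zpow_natCast,
    pow_card_eq_one', one_zpow, mul_one]

variable {F : Type*} [Field F] [Finite F] {d : ℕ} {ω : Fˣ}

theorem pos_of_dvd_card_sub_one (hd : d ∣ Nat.card F - 1) : 0 < d :=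
  Nat.pos_of_dvd_of_pos hd (by have := Finite.one_lt_card (α := F); omega)

theorem card_sub_one_div_ne_zero (hd : d ∣ Nat.card F - 1) : (Nat.card F - 1) / d ≠ 0 :=
  (Nat.div_pos (Nat.le_of_dvd (by have := Finite.one_lt_card (α := F); omega) hd)
    (pos_of_dvd_card_sub_one hd)).ne'

/-- The bijection `(i, z) ↦ ω ^ (i + d z)`, which maps `{i} × ℤ/mℤ` to the coset `C_i`. -/
noncomputable def blockEquiv (hd : d ∣ Nat.card F - 1) (hω : IsPrimitiveElt ω) :
    Fin d × ZMod ((Nat.card F - 1) / d) ≃ Fˣ :=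
  Equiv.ofBijective (fun x => ω ^ ((x.1 : ℕ) + d * (x.2.cast : ℤ) : ℤ)) (by
    have : NeZero ((Nat.card F - 1) / d) := ⟨card_sub_one_div_ne_zero hd⟩
    refine Function.Surjective.bijective_of_nat_card_le (fun y => ?_) ?_
    · obtain ⟨i, _, ⟨c, rfl⟩, rfl⟩ := coset_eq_coset hd hω y
      obtain ⟨n, rfl⟩ := hω c
      refine ⟨(i, (n : ZMod _)), ?_⟩
      simp only
      rw [zpow_add_mul_congr hd ω i (ZMod.intCast_zmod_cast (n : ZMod ((Nat.card F - 1) / d)))]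
      simp [zpow_add, mul_comm (d : ℤ), zpow_mul]
    · rw [Nat.card_prod, Nat.card_units, Nat.card_zmod, Nat.card_fin, Nat.mul_div_cancel' hd])

variable (hd : d ∣ Nat.card F - 1) (hω : IsPrimitiveElt ω)

theorem blockEquiv_intCast (i : Fin d) (z : ℤ) :
    blockEquiv hd hω (i, (z : ZMod _)) = ω ^ ((i : ℕ) + d * z : ℤ) :=
  zpow_add_mul_congr hd ω i (by simp)

theorem exists_blockEquiv (x : Fˣ) : ∃ (i : Fin d) (z : ℤ),
    x = blockEquiv hd hω (i, (z : ZMod _)) := by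
  obtain ⟨⟨i, t⟩, rfl⟩ := (blockEquiv hd hω).surjective x
  obtain ⟨z, rfl⟩ := ZMod.intCast_surjective t
  exact ⟨i, z, rfl⟩

theorem blockEquiv_mem_coset (i : Fin d) (t : ZMod ((Nat.card F - 1) / d)) :
    blockEquiv hd hω (i, t) ∈ coset ω d i := by
  obtain ⟨z, rfl⟩ := ZMod.intCast_surjective t
  refine ⟨_, ⟨ω ^ z, rfl⟩, ?_⟩
  rw [blockEquiv_intCast]
  simp [zpow_add, mul_comm (d : ℤ), zpow_mul]

theorem exists_of_mem_coset {i : ℕ} (hi : i < d) {x : Fˣ} (hx : x ∈ coset ω d i) :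
    ∃ z : ℤ, x = blockEquiv hd hω (⟨i, hi⟩, (z : ZMod _)) := by
  obtain ⟨_, ⟨c, rfl⟩, rfl⟩ := hx
  obtain ⟨n, rfl⟩ := hω c
  refine ⟨n, ?_⟩
  rw [blockEquiv_intCast]
  simp [zpow_add, mul_comm (d : ℤ), zpow_mul]

/-- Raising to the power `r i` on a coset is affine in `z` with slope `r i`; bijectivity forces the
slope to be a unit modulo `m`. Conversely, every affine map between blocks is a monomial map. -/
theorem isGCP_iff {g : Perm Fˣ} : IsGCP d g ↔
    IsBlockMap (Hol _) ((blockEquiv hd hω).symm.permCongr g) := by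
  have : NeZero ((Nat.card F - 1) / d) := ⟨card_sub_one_div_ne_zero hd⟩
  have hE : ∀ (σ : Fin d → Fin d) (h : Fin d → Hol ((Nat.card F - 1) / d)),
      (∀ i t, (blockEquiv hd hω).symm.permCongr g (i, t) = (σ i, (h i).1 t)) ↔
      ∀ i t, g (blockEquiv hd hω (i, t)) = blockEquiv hd hω (σ i, (h i).1 t) := fun σ h => by
    simp [Equiv.permCongr_apply, Equiv.symm_apply_eq]
  constructor
  · rintro ⟨f, hf, -, hfg⟩
    obtain ⟨a, r, -, -, h⟩ := (isGenCyclotomicMapping_iff_of_primitive hd hω).1 hf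
    have h1 : ∀ i : Fin d, ∃ (j : Fin d) (s : ℤ), ∀ z : ℤ,
        g (blockEquiv hd hω (i, (z : ZMod _))) =
          blockEquiv hd hω (j, ((r i : ℤ) * z + s : ℤ)) := fun i => by
      obtain ⟨j, s, hj⟩ := exists_blockEquiv hd hω (g (blockEquiv hd hω (i, ((0 : ℤ) : ZMod _))))
      refine ⟨j, s, fun z => ?_⟩
      have h0 := h i _ (blockEquiv_mem_coset hd hω i ((0 : ℤ) : ZMod _))
      have hz := h i _ (blockEquiv_mem_coset hd hω i (z : ZMod _))
      have hez : blockEquiv hd hω (i, (z : ZMod _)) =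
          blockEquiv hd hω (i, ((0 : ℤ) : ZMod _)) * ω ^ (d * z : ℤ) := by
        rw [blockEquiv_intCast, blockEquiv_intCast, ← zpow_add, mul_zero, add_zero]
      rw [hfg] at h0 hz
      have : g (blockEquiv hd hω (i, (z : ZMod _))) =
          g (blockEquiv hd hω (i, ((0 : ℤ) : ZMod _))) * (ω ^ (d * z : ℤ)) ^ r i := by
        refine Units.ext ?_
        rw [Units.val_mul, hz, h0, hez, Units.val_mul, mul_pow, mul_assoc, Units.val_pow_eq_pow_val]
      rw [this, hj, blockEquiv_intCast, blockEquiv_intCast, ← zpow_natCast, ← zpow_mul, ← zpow_add]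
      congr 1
      ring
    choose σ s hσ using h1
    have hσt : ∀ i t, g (blockEquiv hd hω (i, t)) = 
        blockEquiv hd hω (σ i, (r i : ZMod _) * t + ((s i : ℤ) : ZMod _)) :=
      fun i t => by
        obtain ⟨z, rfl⟩ := ZMod.intCast_surjective t
        rw [hσ]
        push_cast
        rfl
    have hsurj : Function.Surjective σ := fun j => by
      obtain ⟨x, hx⟩ := g.surjective (blockEquiv hd hω (j, 0))
      obtain ⟨i, z, rfl⟩ := exists_blockEquiv hd hω x
      rw [hσ, (blockEquiv hd hω).injective.eq_iff] at hx
      exact ⟨i, congrArg Prod.fst hx⟩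
    have hu : ∀ i, IsUnit (r i : ZMod ((Nat.card F - 1) / d)) := fun i => by
      have hinj : Function.Injective fun t : ZMod ((Nat.card F - 1) / d) => (r i : ZMod _) * t :=
        fun t t' htt => by
          have : g (blockEquiv hd hω (i, t)) = g (blockEquiv hd hω (i, t')) := by
            rw [hσt, hσt]
            exact congrArg (fun y => blockEquiv hd hω (σ i, y + ((s i : ℤ) : ZMod _))) htt
          simpa using this
      obtain ⟨y, hy⟩ := (Finite.injective_iff_surjective.1 hinj) 1
      exact IsUnit.of_mul_eq_one _ hy
    refine ⟨Equiv.ofBijective σ (Finite.surjective_iff_bijective.1 hsurj),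
      fun i => hol (hu i).unit (s i), (hE _ _).2 ?_⟩
    simpa [hol_apply] using hσt
  · rintro ⟨σ, h, hg⟩
    rw [hE] at hg
    choose u b hub using fun i => exists_hol_eq (h i)
    classical
    refine ⟨fun x => if hx : x = 0 then 0 else g (Units.mk0 x hx),
      (isGenCyclotomicMapping_iff_coset hd).2 ⟨by simp, fun y => ?_⟩, ⟨fun x y hxy => ?_, fun y => ?_⟩,
      fun x => by simp⟩
    · obtain ⟨i, z, rfl⟩ := exists_blockEquiv hd hω y
      obtain ⟨v, hv⟩ := ZMod.intCast_surjective (b i)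
      -- Adding `m` keeps the residue and ensures `r ≥ 1`, even for `m = 1`, where the residue is
      -- `0`. The coefficient's exponent is determined by `r (i + d z) + (σ i + d v - r i) = σ i + d
      -- (r z + v)`.
      set r : ℕ := (u i : ZMod ((Nat.card F - 1) / d)).val + (Nat.card F - 1) / d with hr
      have hur : (u i : ZMod ((Nat.card F - 1) / d)) = r := by simp [hr]
      refine ⟨(ω ^ ((σ i : ℕ) + d * v - r * (i : ℕ) : ℤ) : Fˣ), r,
        by have := NeZero.pos ((Nat.card F - 1) / d); omega, ?_⟩
      rintro _ ⟨c, rfl⟩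
      obtain ⟨n, rfl⟩ := hω c
      have hzn : blockEquiv hd hω (i, (z : ZMod _)) * powMonoidHom d (ω ^ n) =
          blockEquiv hd hω (i, ((z + n : ℤ) : ZMod _)) := by
        rw [blockEquiv_intCast, blockEquiv_intCast, powMonoidHom_apply, ← zpow_natCast, ← zpow_mul,
          ← zpow_add]
        congr 1
        ring
      rw [← Units.val_mul, hzn, dif_neg (Units.ne_zero _), Units.mk0_val, hg, hub, hol_apply, hur,
        ← hv, ← Units.val_pow_eq_pow_val, ← Units.val_mul]
      have hc : (r : ZMod ((Nat.card F - 1) / d)) * ((z + n : ℤ) : ZMod _) + (v : ZMod _) =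
        ((r * (z + n) + v : ℤ) : ZMod _) := by push_cast; rfl
      rw [hc, blockEquiv_intCast, blockEquiv_intCast, ← zpow_natCast, ← zpow_mul, ← zpow_add]
      congr 2
      ring
    · by_cases hx : x = 0 <;> by_cases hy : y = 0
      · rw [hx, hy]
      · simp only [hx, hy, dite_true, dite_false] at hxy
        exact (Units.ne_zero _ hxy.symm).elim
      · simp [hx, hy] at hxy
      · simp only [hx, hy, dite_false] at hxy
        exact congrArg Units.val (g.injective (Units.ext hxy))
    · by_cases hy : y = 0
      · exact ⟨0, by simp [hy]⟩
      · exact ⟨g.symm (Units.mk0 y hy), by simp⟩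

theorem isConj_iff_exists_blockMap (g g' : GCP F d hd) : IsConj g g' ↔
    ∃ w : Perm (Fin d × ZMod ((Nat.card F - 1) / d)), IsBlockMap (Hol _) w ∧
      ∀ x, w ((blockEquiv hd hω).symm.permCongr g.1 x) =
        (blockEquiv hd hω).symm.permCongr g'.1 (w x) := by
  rw [isConj_iff]
  constructor
  · rintro ⟨c, rfl⟩
    refine ⟨(blockEquiv hd hω).symm.permCongr c.1, (isGCP_iff hd hω).1 c.2, fun x => ?_⟩
    simp [Equiv.permCongr_apply]
  · rintro ⟨w, hw, h⟩
    refine ⟨⟨(blockEquiv hd hω).permCongr w, (isGCP_iff hd hω).2 (by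
      convert hw
      ext x <;> simp [Equiv.permCongr_apply])⟩, ?_⟩
    rw [mul_inv_eq_iff_eq_mul]
    refine Subtype.ext (Equiv.ext fun y => ?_)
    have := h ((blockEquiv hd hω).symm y)
    simpa [Equiv.permCongr_apply, Equiv.eq_symm_apply] using this

/-- The element of `GCP(d, q)` that corresponds to a block map. -/
noncomputable def gcpOfBlockMap (w : Perm (Fin d × ZMod ((Nat.card F - 1) / d)))
    (hw : IsBlockMap (Hol _) w) : GCP F d hd :=
  ⟨(blockEquiv hd hω).permCongr w, (isGCP_iff hd hω).2 (by
      convert hw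
      ext x <;> simp [Equiv.permCongr_apply])⟩

theorem permCongr_gcpOfBlockMap {w : Perm (Fin d × ZMod ((Nat.card F - 1) / d))}
    (hw : IsBlockMap (Hol _) w) :
    (blockEquiv hd hω).symm.permCongr (gcpOfBlockMap hd hω w hw).1 = w := by
  ext x <;> simp [gcpOfBlockMap, Equiv.permCongr_apply]

theorem gcpOfBlockMap_apply {w : Perm (Fin d × ZMod ((Nat.card F - 1) / d))}
    (hw : IsBlockMap (Hol _) w) (x) :
    (gcpOfBlockMap hd hω w hw).1 (blockEquiv hd hω x) = blockEquiv hd hω (w x) := by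
  simp [gcpOfBlockMap, Equiv.permCongr_apply]

end BlockEquiv

/-! ### The two complete systems of representatives -/

section Representatives

open Equiv

theorem isCycleOn_permCongr {X Y : Type*} (e : X ≃ Y) {f : Perm X}
    (hf : f.IsCycleOn Set.univ) : (e.permCongr f).IsCycleOn Set.univ := by
  rw [isCycleOn_univ_iff] at hf ⊢
  intro x y
  obtain ⟨n, hn⟩ := hf (e.symm x) (e.symm y)
  refine ⟨n, ?_⟩
  have : e.permCongr f ^ n = e.permCongr (f ^ n) := (map_zpow e.permCongrHom f n).symm
  rw [this, Equiv.permCongr_apply, hn, e.apply_symm_apply]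

theorem IsBlockMap.permCongr {I J T : Type*} {H : Subgroup (Perm T)} {s : I × T ≃ J × T}
    (hs : IsBlockMap H s) {g : Perm (I × T)} (hg : IsBlockMap H g) :
    IsBlockMap H (s.permCongr g) :=
  (hs.symm.trans hg).trans hs

/-- The bijection that lists the blocks of an involution: `k` pairs, followed by `n` single
blocks. -/
def splitEquiv {k n d : ℕ} (h : k * 2 + n = d) : (Fin k × Fin 2) ⊕ Fin n ≃ Fin d :=
  ((Equiv.sumCongr finProdFinEquiv (Equiv.refl _)).trans finSumFinEquiv).trans (finCongr h)

theorem splitEquiv_inl {k n d : ℕ} (h : k * 2 + n = d) (i : Fin k) (b : Fin 2) :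
    ((splitEquiv h (Sum.inl (i, b)) : Fin d) : ℕ) = b + 2 * i := by
  simp [splitEquiv]

theorem splitEquiv_inr {k n d : ℕ} (h : k * 2 + n = d) (j : Fin n) :
    ((splitEquiv h (Sum.inr j) : Fin d) : ℕ) = k * 2 + j := by
  simp [splitEquiv]

/-- `splitEquiv`, applied to the blocks. -/
def splitBlocks {k n d : ℕ} (h : k * 2 + n = d) (T : Type*) :
    ((Fin k × Fin 2) ⊕ Fin n) × T ≃ Fin d × T :=
  (splitEquiv h).prodCongr (Equiv.refl T)

theorem isBlockMap_splitBlocks {k n d : ℕ} (h : k * 2 + n = d) {T : Type*}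
    (H : Subgroup (Perm T)) : IsBlockMap H (splitBlocks h T) :=
  ⟨splitEquiv h, 1, fun _ _ => rfl⟩

theorem coeffs_injective {m : ℕ} (hm : m ≠ 0) : Function.Injective (coeffs (m := m)) :=
  fun g g' h => Subtype.ext (Equiv.ext fun x => by
    rw [(coeffs_spec (Nat.pos_of_ne_zero hm) g).2.2.2, h,
      (coeffs_spec (Nat.pos_of_ne_zero hm) g').2.2.2])

variable {F : Type*} [Field F] [Finite F] {d : ℕ} {ω : Fˣ}
  (hd : d ∣ Nat.card F - 1) (hω : IsPrimitiveElt ω)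

theorem isInvolution_iff (g : GCP F d hd) : IsInvolution g ↔
    ∀ x, (blockEquiv hd hω).symm.permCongr g.1 ((blockEquiv hd hω).symm.permCongr g.1 x) = x := by
  simp only [Equiv.permCongr_apply, Equiv.symm_symm, Equiv.symm_apply_eq,
    Equiv.apply_symm_apply]
  rw [IsInvolution, Subtype.ext_iff, Equiv.ext_iff, ← (blockEquiv hd hω).forall_congr_right]
  rfl

theorem isLongCycle_iff (g : GCP F d hd) : IsLongCycle g ↔
    ((blockEquiv hd hω).symm.permCongr g.1).IsCycleOn Set.univ :=
  ⟨fun h => isCycleOn_permCongr _ h, fun h => by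
    have := isCycleOn_permCongr (blockEquiv hd hω) h
    rwa [← Equiv.permCongr_symm, Equiv.apply_symm_apply] at this⟩

theorem gcpOfBlockMap_conj_iff {w w' : Perm (Fin d × ZMod ((Nat.card F - 1) / d))}
    (hw : IsBlockMap (Hol _) w) (hw' : IsBlockMap (Hol _) w') :
    IsConj (gcpOfBlockMap hd hω w hw) (gcpOfBlockMap hd hω w' hw') ↔
      ∃ v : Perm (Fin d × ZMod ((Nat.card F - 1) / d)), IsBlockMap (Hol _) v ∧
        ∀ x, v (w x) = w' (v x) := by
  simp only [isConj_iff_exists_blockMap hd hω, permCongr_gcpOfBlockMap]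

/-- The multiplier `a ∈ LIndex m` as a unit of `ℤ/mℤ`. -/
def unitOfLIndex {m : ℕ} (hm : m ≠ 0) (a : LIndex m) : (ZMod m)ˣ :=
  ZMod.unitOfCoprime a (coprime_of_mem_LIndex hm a.2)

theorem longCycle_system (hd : d ∣ Nat.card F - 1) (hω : IsPrimitiveElt ω) :
    ∃ L : LIndex ((Nat.card F - 1) / d) → GCP F d hd,
      (∀ a : LIndex ((Nat.card F - 1) / d), IsL ω d a (L a).1) ∧
      IsCompleteSystem IsLongCycle L := by
  obtain ⟨n, rfl⟩ := Nat.exists_eq_succ_of_ne_zero (pos_of_dvd_card_sub_one hd).ne'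
  have hm := card_sub_one_div_ne_zero hd
  have : NeZero ((Nat.card F - 1) / (n + 1)) := ⟨hm⟩
  refine ⟨fun a => gcpOfBlockMap hd hω (blockCycle n (hol (unitOfLIndex hm a) 1))
    (isBlockMap_blockCycle _ _), fun a => ⟨fun x hx => ?_, fun x hx => ?_⟩, fun a => ?_,
    fun g hg => ?_⟩
  · obtain ⟨⟨i, hi⟩, z, rfl⟩ := exists_blockEquiv hd hω x
    have hin : i < n := by
      refine lt_of_le_of_ne (Nat.lt_succ_iff.1 hi) ?_
      rintro rfl
      exact hx (blockEquiv_mem_coset hd hω _ _)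
    rw [gcpOfBlockMap_apply, blockCycle_of_lt n _ hin, blockEquiv_intCast, blockEquiv_intCast,
      ← zpow_one_add]
    congr 1
    push_cast
    ring
  · obtain ⟨z, rfl⟩ := exists_of_mem_coset hd hω (Nat.lt_succ_self n) hx
    have hc : ((unitOfLIndex hm a : (ZMod _)ˣ) : ZMod ((Nat.card F - 1) / (n + 1))) * (z : ZMod _) + 1 =
        (((a : ℕ) * z + 1 : ℤ) : ZMod _) := by
      simp [unitOfLIndex]
    have := blockCycle_last n (hol (unitOfLIndex hm a) 1) (z : ZMod _)
    rw [gcpOfBlockMap_apply]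
    erw [this]
    -- With `d = n + 1`, the exponents agree since `d - n a + a (n + d z) = d (a z + 1)`.
    rw [hol_apply, hc, blockEquiv_intCast, blockEquiv_intCast, ← zpow_natCast, ← zpow_mul, ← zpow_add]
    congr 1
    push_cast
    simp only [Fin.val_zero]
    push_cast
    ring
  · rw [isLongCycle_iff hd hω, permCongr_gcpOfBlockMap]
    exact isCycleOn_blockCycle (isCycleOn_lam_one hm (a := (a : ℕ)) (by simp [unitOfLIndex])
      (rad'_dvd_sub_one_of_mem_LIndex a.2))
  · rw [isLongCycle_iff hd hω] at hg
    obtain ⟨c, w, hw, hwc⟩ := exists_conj_blockCycle ((isGCP_iff hd hω).1 g.2) hg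
    have hc : c.1.IsCycleOn Set.univ := by
      refine isCycleOn_of_isCycleOn_blockCycle (n := n) ?_
      -- The block cycle is `g` conjugated by `w`, so it inherits the full cycle.
      convert isCycleOn_permCongr w.symm hg using 1
      exact Equiv.ext fun x => by simp [← hwc]
    obtain ⟨a, ha, u, hu, v, hv⟩ := exists_conj_hol_one hm hc
    obtain rfl : u = unitOfLIndex hm ⟨a, ha⟩ := Units.ext (by simp [hu, unitOfLIndex])
    have hag := ((gcpOfBlockMap_conj_iff hd hω (isBlockMap_blockCycle n _)
      (isBlockMap_blockCycle n _)).2 (blockCycle_conj hv)).trans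
      ((isConj_iff_exists_blockMap hd hω _ g).2 ⟨w, hw, fun x => by
        rw [permCongr_gcpOfBlockMap, hwc]⟩)
    refine ⟨⟨a, ha⟩, hag, fun a' ha' => Subtype.ext ?_⟩
    obtain ⟨w', hw', h'⟩ := (gcpOfBlockMap_conj_iff hd hω _ _).1 (ha'.trans hag.symm)
    obtain ⟨v', hv'⟩ := exists_conj_of_blockCycle_conj hw' h'
    exact eq_of_mem_LIndex hm a'.2 ha
      (by simpa [unitOfLIndex] using congrArg Units.val (eq_of_conj_hol_one hv'))

theorem isI_gcpOfBlockMap {k : ℕ} (hk : k * 2 + (d - 2 * k) = d)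
    (t : Fin (d - 2 * k) → Hol ((Nat.card F - 1) / d))
    (h : IsBlockMap (Hol _) ((splitBlocks hk _).permCongr (blockInv k t))) :
    IsI ω d k t (gcpOfBlockMap hd hω _ h).1 := by
  have key : ∀ y, (gcpOfBlockMap hd hω _ h).1 (blockEquiv hd hω (splitBlocks hk _ y)) =
      blockEquiv hd hω (splitBlocks hk _ (blockInv k t y)) := fun y => by
    rw [gcpOfBlockMap_apply, Equiv.permCongr_apply, Equiv.symm_apply_apply]
  have hs : ∀ (y : (Fin k × Fin 2) ⊕ Fin (d - 2 * k)) (z : ℤ),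
      blockEquiv hd hω (splitBlocks hk _ (y, (z : ZMod _))) =
        ω ^ ((splitEquiv hk y : ℕ) + d * z : ℤ) := fun y z => blockEquiv_intCast hd hω _ z
  have hx : ∀ (y : (Fin k × Fin 2) ⊕ Fin (d - 2 * k)) (i : ℕ), (splitEquiv hk y : ℕ) = i →
      ∀ x ∈ coset ω d i, ∃ z : ℤ, x = blockEquiv hd hω (splitBlocks hk _ (y, (z : ZMod _))) := by
    rintro y _ rfl x hx
    exact exists_of_mem_coset hd hω (splitEquiv hk y).2 hx
  refine ⟨fun i hi x hxi => ?_, fun i hi x hxi => ?_, fun j x hxj => ?_⟩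
  · obtain ⟨z, rfl⟩ := hx (Sum.inl (⟨i, hi⟩, 0)) _ (by simp [splitEquiv_inl]) x hxi
    rw [key, blockInv_inl, hs, hs, splitEquiv_inl, splitEquiv_inl, ← zpow_one_add]
    congr 1
    simp
    ring
  · obtain ⟨z, rfl⟩ := hx (Sum.inl (⟨i, hi⟩, 1)) _ (by simp [splitEquiv_inl, add_comm]) x hxi
    rw [key, blockInv_inl, hs, hs, splitEquiv_inl, splitEquiv_inl, ← zpow_neg_one, ← zpow_add]
    congr 1
    simp
    ring
  · obtain ⟨z, rfl⟩ := hx (Sum.inr j) _ (by simp [splitEquiv_inr, mul_comm]) x hxj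
    have hc := (coeffs_spec (Nat.pos_of_ne_zero (card_sub_one_div_ne_zero hd)) (t j)).2.2.2 z
    have hc' : ((coeffs (t j)).1 : ZMod ((Nat.card F - 1) / d)) * (z : ZMod _) +
        ((coeffs (t j)).2 : ZMod _) = (((coeffs (t j)).1 * z + (coeffs (t j)).2 : ℤ) : ZMod _) := by
      push_cast
      rfl
    rw [key, blockInv_inr, hc, hc', hs, hs, splitEquiv_inr, ← zpow_natCast, ← zpow_mul, ← zpow_add]
    -- With `i = 2k + j`, this is `d b + (1 - a) i + a (i + d z) = i + d (a z + b)`.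
    congr 1
    push_cast
    ring

theorem involution_system (hd : d ∣ Nat.card F - 1) (hω : IsPrimitiveElt ω)
    (R : Set (Hol ((Nat.card F - 1) / d)))
    (hR : IsCompleteSystem IsInvolution (Subtype.val : R → Hol ((Nat.card F - 1) / d))) :
    ∃ I : IIndex d ((Nat.card F - 1) / d) R → GCP F d hd,
      (∀ p, IsI ω d p.k p.t (I p).1) ∧ IsCompleteSystem IsInvolution I := by
  have hm := card_sub_one_div_ne_zero hd
  have hsplit : ∀ p : IIndex d ((Nat.card F - 1) / d) R, p.k * 2 + (d - 2 * p.k) = d := fun p => by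
    have := p.hk
    omega
  have hblock : ∀ p : IIndex d ((Nat.card F - 1) / d) R,
      IsBlockMap (Hol _) ((splitBlocks (hsplit p) _).permCongr (blockInv p.k p.t)) := fun p =>
    (isBlockMap_splitBlocks _ _).permCongr (isBlockMap_blockInv _ _)
  have hR1 : ∀ g : Hol ((Nat.card F - 1) / d), IsInvolution g → ∃ r ∈ R, IsConj r g := fun g hg =>
    let ⟨r, hr, _⟩ := hR.2 g hg
    ⟨r, r.2, hr⟩
  have hR2 : ∀ r ∈ R, ∀ r' ∈ R, IsConj r r' → r = r' := fun r hr r' hr' h =>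
    congrArg Subtype.val ((hR.2 r' (hR.1 ⟨r', hr'⟩)).unique (y₁ := ⟨r, hr⟩) (y₂ := ⟨r', hr'⟩) h
      (IsConj.refl _))
  refine ⟨fun p => gcpOfBlockMap hd hω _ (hblock p), fun p => isI_gcpOfBlockMap hd hω _ _ _,
    fun p => ?_, fun g hg => ?_⟩
  · rw [isInvolution_iff hd hω, permCongr_gcpOfBlockMap]
    intro x
    simp only [Equiv.permCongr_apply, Equiv.symm_apply_apply]
    rw [blockInv_blockInv (fun j => hR.1 ⟨_, p.mem j⟩), Equiv.apply_symm_apply]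
  · rw [isInvolution_iff hd hω] at hg
    obtain ⟨k, n, t, htR, htm, w, hw, hwg⟩ := exists_conj_blockInv (fun g => toLex (coeffs g)) hR1
      ((isGCP_iff hd hω).1 g.2) hg ⟨0⟩
    -- Counting blocks fixes the number of unpaired ones.
    have hkn : k * 2 + n = d := by
      obtain ⟨σ, -⟩ := hw
      simpa using Fintype.card_congr σ
    obtain rfl : n = d - 2 * k := by omega
    let p : IIndex d ((Nat.card F - 1) / d) R := ⟨k, by omega, t, htR, fun i j h => htm h⟩
    have hpg : IsConj (gcpOfBlockMap hd hω _ (hblock p)) g := by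
      refine (isConj_iff_exists_blockMap hd hω _ g).2 ⟨(splitBlocks (hsplit p) _).symm.trans w,
        (isBlockMap_splitBlocks _ _).symm.trans hw, fun x => ?_⟩
      rw [permCongr_gcpOfBlockMap]
      simp only [Equiv.permCongr_apply, Equiv.trans_apply, Equiv.symm_apply_apply]
      exact hwg _
    refine ⟨p, hpg, fun p' hp' => ?_⟩
    obtain ⟨v, hv, hvp⟩ := (gcpOfBlockMap_conj_iff hd hω _ _).1 (hp'.trans hpg.symm)
    obtain ⟨hn, ht⟩ := eq_of_blockInv_conj (toLex.injective.comp (coeffs_injective hm)) hR2 p'.mem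
      p.mem (fun i j h => p'.ordered i j h) (fun i j h => p.ordered i j h)
      (((isBlockMap_splitBlocks (hsplit p') _).trans hv).trans
        (isBlockMap_splitBlocks (hsplit p) _).symm) (fun x => by
          have := hvp (splitBlocks (hsplit p') _ x)
          simp only [Equiv.permCongr_apply, Equiv.symm_apply_apply] at this
          simp only [Equiv.trans_apply, this, Equiv.symm_apply_apply]) ⟨0⟩
    clear_value p
    obtain ⟨k₁, hk₁, t₁, h₁, h₁'⟩ := p
    obtain ⟨k₂, hk₂, t₂, h₂, h₂'⟩ := p'
    -- Equal tuple lengths determine `k` only because truncation in `d - 2k` is excluded by `k ≤ d /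
    -- 2`.
    obtain rfl : k₁ = k₂ := by
      simp only at hn
      omega
    obtain rfl := eq_of_heq ht
    rfl

end Representatives

end GenCyc

theorem mainTheorem7 {F : Type*} [Field F] [Finite F] (d : ℕ) (hd : d ∣ Nat.card F - 1)
    (ω : Fˣ) (hω : GenCyc.IsPrimitiveElt ω) :
    (∃ L : GenCyc.LIndex ((Nat.card F - 1) / d) → GenCyc.GCP F d hd,
      (∀ a : GenCyc.LIndex ((Nat.card F - 1) / d), GenCyc.IsL ω d a (L a).1) ∧
      GenCyc.IsCompleteSystem GenCyc.IsLongCycle L) ∧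
    (∀ R : Set (GenCyc.Hol ((Nat.card F - 1) / d)),
      GenCyc.IsCompleteSystem GenCyc.IsInvolution
        (Subtype.val : R → GenCyc.Hol ((Nat.card F - 1) / d)) →
      ∃ I : GenCyc.IIndex d ((Nat.card F - 1) / d) R → GenCyc.GCP F d hd,
        (∀ p, GenCyc.IsI ω d p.k p.t (I p).1) ∧
        GenCyc.IsCompleteSystem GenCyc.IsInvolution I) :=
  ⟨GenCyc.longCycle_system hd hω, GenCyc.involution_system hd hω⟩
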